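/- **Setting.** There are $n$ agents and $m\ge 1$ identical units of a good. Agent $i$ has a type $\vec\theta_i\in[0,1]^m$, where $\theta_i[\mu]$ is her value for the $\mu$-th additional unit, and submits a bid vector $\hat{\vec\theta}_i\in[0,1]^m$. All $nm$ bids are ranked in decreasing order, ties being broken by an arbitrary fixed priority order on the bids. If exactly $m_i$ of agent $i$'s bids are among the $m$ highest, she is awarded $m_i$ units. In the *discriminatory* auction her utility is $\sum_{\mu=1}^{m_i}(\theta_i[\mu]-\hat\theta_i[\mu])$. In the *uniform-price* auction it is $\sum_{\mu=1}^{m_i}\theta_i[\mu]-m_i p$, where $p$ is the highest losing bid ($p=0$ if no bid loses). Write $u_i(\vec\theta_i,\hat{\vec\theta}_i,\vec\theta_{-i})$ for agent $i$'s utility when she has type $\vec\theta_i$, bids $\hat{\vec\theta}_i$, and the other agents bid truthfully. **Dispersion.** Functions $f_1,\dots,f_N:[0,1]^m\to\mathbb R$ are *piecewise $L$-Lipschitz and $(w,k)$-dispersed* if there are finite partitions $\mathcal P_1,\dots,\mathcal P_N$ of $[0,1]^m$ such that each $f_j$ is $L$-Lipschitz in the $\ell_1$-norm on every piece of $\mathcal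 P_j$, and every closed $\ell_1$-ball of radius $w$ in $\mathbb R^m$ meets two or more pieces of $\mathcal P_j$ for at most $k$ of the indices $j$. **Theorem.** For every constant $c>0$ there is a constant $C>0$, depending only on $c$, such that the following holds for all $n$, all $m,N\ge 1$, $\kappa>0$, $\delta\in(0,1)$ and every tie-breaking order. Let the agents' types be independent, $\vec\theta_i\sim\mathcal D_i$ with $\mathcal D_i$ supported in $[0,1]^m$, and suppose that each marginal value $\theta_i[\mu]$ has a density bounded by $\kappa$. For each agent $i$ let $\vec\theta^{(1)}_{-i},\dots,\vec\theta^{(N)}_{-i}$ be independent draws from $\mathcal D_{-i}=\prod_{i'\ne i}\mathcal D_{i'}$ (the $n$ sample sets may depend on each other in any way). Put $$w=\frac{c}{\kappa\sqrt N},\qquad k=C\,n m^2\sqrt{N\log\frac n\delta}.$$ Then with probability at least $1-\delta$ over the draw of the $n$ sample sets, for all agents $i$ and all types $\vec\theta_i\in[0,1]^m$ simultaneously: 1. for the discriminatory auction, the functions $u_i(\vec\theta_i,\cdot,\vec\theta^{(1)}_{-i}),\dots,u_i(\vec\theta_i,\cdot,\vec\theta^{(N)}_{-i})$ on $[0,1]^m$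 are piecewise $1$-Lipschitz and $(w,k)$-dispersed; 2. for the uniform-price auction, the functions $u_i(\vec\theta_i,\cdot,\vec\theta^{(1)}_{-i}),\dots,u_i(\vec\theta_i,\cdot,\vec\theta^{(N)}_{-i})$ on $[0,1]^m$ are piecewise $(m-1)$-Lipschitz and $(w,k)$-dispersed. -/

import Mathlib

open MeasureTheory

noncomputable section

/-- The unit cube `[0,1]^m`: the space of true types and of reported bid vectors. -/
def unitCube (m : ℕ) : Set (Fin m → ℝ) := {x | ∀ μ, 0 ≤ x μ ∧ x μ ≤ 1}

/-- The `ℓ₁`-distance on `ℝ^m`. -/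
def l1Dist {m : ℕ} (x y : Fin m → ℝ) : ℝ := ∑ μ, |x μ - y μ|

/-- The law `ν` on the real line has a density bounded by `κ`. -/
def HasBoundedDensity (κ : ℝ) (ν : Measure ℝ) : Prop :=
  ∃ f : ℝ → ENNReal, Measurable f ∧ (∀ x, f x ≤ ENNReal.ofReal κ) ∧ ν = volume.withDensity f

/-! ### Partitions, piecewise Lipschitz functions, dispersion -/

/-- `Q` is a partition of `D` into finitely many pieces, and `u` is `L`-Lipschitz
with respect to the `ℓ₁`-norm on each piece. -/
structure IsPiecewiseLipschitzOver {m : ℕ} (D : Set (Fin m → ℝ)) (L : ℝ)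
    (u : (Fin m → ℝ) → ℝ) (Q : Set (Set (Fin m → ℝ))) : Prop where
  finite : Q.Finite
  nonempty : ∀ R ∈ Q, R.Nonempty
  disjoint : Q.PairwiseDisjoint id
  cover : ⋃₀ Q = D
  lipschitz : ∀ R ∈ Q, ∀ x ∈ R, ∀ y ∈ R, |u x - u y| ≤ L * l1Dist x y

/-- The family of sets `Q` splits `A` if `A` intersects at least two sets of `Q`. -/
def Splits {m : ℕ} (Q : Set (Set (Fin m → ℝ))) (A : Set (Fin m → ℝ)) : Prop :=
  ∃ R ∈ Q, ∃ R' ∈ Q, R ≠ R' ∧ (A ∩ R).Nonempty ∧ (A ∩ R').Nonempty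

/-- The functions `u 1, …, u N` on `D` are piecewise `L`-Lipschitz and `(w, k)`-dispersed:
`u j` is piecewise `L`-Lipschitz over a partition `Q j` of `D`, and every closed `ℓ₁`-ball of
radius `w` is split by at most `k` of the partitions `Q 1, …, Q N`. -/
def PiecewiseLipschitzDispersed {m N : ℕ} (D : Set (Fin m → ℝ)) (L w k : ℝ)
    (u : Fin N → (Fin m → ℝ) → ℝ) : Prop :=
  ∃ Q : Fin N → Set (Set (Fin m → ℝ)),
    (∀ j, IsPiecewiseLipschitzOver D L (u j) (Q j)) ∧
    ∀ p : Fin m → ℝ, (Set.ncard {j | Splits (Q j) {x | l1Dist p x ≤ w}} : ℝ) ≤ k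

/-! ### Multi-unit auctions: `n` agents, `m` identical units, `m` bids per agent -/

/-- The profile in which agent `i` bids `x` and the other agents bid `y`. -/
def bidProfile {n m : ℕ} (i : Fin n) (x : Fin m → ℝ) (y : {i' : Fin n // i' ≠ i} → Fin m → ℝ) :
    Fin n → Fin m → ℝ :=
  fun i' => if h : i' = i then x else y ⟨i', h⟩

/-- Bid `p` is ranked before bid `q`: it is higher, or it is equal and has priority.
(A bid is indexed by its agent and its unit; `prio` only breaks ties.) -/
def RankedBefore {n m : ℕ} (prio : Fin n × Fin m → ℕ) (b : Fin n → Fin m → ℝ)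
    (p q : Fin n × Fin m) : Prop :=
  b q.1 q.2 < b p.1 p.2 ∨ (b p.1 p.2 = b q.1 q.2 ∧ prio p < prio q)

/-- Bid `p` is among the `m` highest of all `n * m` bids. -/
def IsWinningBid {n m : ℕ} (prio : Fin n × Fin m → ℕ) (b : Fin n → Fin m → ℝ)
    (p : Fin n × Fin m) : Prop :=
  Set.ncard {q | RankedBefore prio b q p} < m

/-- The number of units awarded to agent `i`: the number of her bids among the `m` highest. -/
def unitsWon {n m : ℕ} (prio : Fin n × Fin m → ℕ) (b : Fin n → Fin m → ℝ) (i : Fin n) : ℕ :=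
  Set.ncard {μ : Fin m | IsWinningBid prio b (i, μ)}

/-- The sum of the first `t` entries of `x`: the value (or the bid) for `t` units when the
entries of `x` are the marginal values (or bids) for each additional unit. -/
def firstUnits {m : ℕ} (x : Fin m → ℝ) (t : ℕ) : ℝ := ∑ μ : Fin m, if μ.val < t then x μ else 0

/-- Discriminatory auction: agent `i` with marginal values `v` pays the amount that she bid for
the number of units she is awarded. -/
def discriminatoryUtility {n m : ℕ} (prio : Fin n × Fin m → ℕ) (i : Fin n) (v : Fin m → ℝ)
    (b : Fin n → Fin m → ℝ) : ℝ :=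
  firstUnits v (unitsWon prio b i) - firstUnits (b i) (unitsWon prio b i)

/-- The market-clearing price of the uniform-price auction: the highest losing bid
(`0` if no bid loses, which happens only for a single agent). -/
def highestLosingBid {n m : ℕ} (prio : Fin n × Fin m → ℕ) (b : Fin n → Fin m → ℝ) : ℝ :=
  sSup {x | ∃ p : Fin n × Fin m, ¬ IsWinningBid prio b p ∧ x = b p.1 p.2}

/-- Uniform-price auction: agent `i` pays the market-clearing price for each unit awarded. -/
def uniformPriceUtility {n m : ℕ} (prio : Fin n × Fin m → ℕ) (i : Fin n) (v : Fin m → ℝ)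
    (b : Fin n → Fin m → ℝ) : ℝ :=
  firstUnits v (unitsWon prio b i) - (unitsWon prio b i : ℝ) * highestLosingBid prio b

end

/-! Partition the cube by the number of units agent `i` wins. On one piece the value term is
constant. The discriminatory payment is a partial sum of bids, hence 1-Lipschitz. The uniform
payment is `t` times the highest losing bid, which moves by at most the largest change in a bid; if
`t = m`, all losing bids belong to the other agents and the price is constant, so the slope is at
most `m - 1`.

The number of units won is determined by how agent `i`'s bids compare with the others' bids
(`unitsWon_bidProfile_congr`). So a ball of radius `w` about `p` is split only if some bid of
another agent lies within `w` of some `p μ` (`exists_abs_sub_le_of_splits`). It remains to bound,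
for every sampled coordinate, the number of samples in any interval of radius `w`.

A nonempty such interval lies within `2w` of one of its sample points, so only `N` windows matter.
Given the central point, the other samples are independent and fall close with probability at most
`β = O(κw)`. The exponential moment of the count and Markov's inequality give a tail `2 exp(βN) / 2
^ T`, with `βN` of order `√N`. A union bound over agent pairs, units and samples finishes the proof;
parameters for which that bound would fail make `k ≥ N`, where nothing is to be shown. -/

/-! ### Allocation and price as functions of one agent's bids -/

/-- In a finite strict total order the rank is a bijection onto an initial segment of `ℕ`. This
yields exactly `m` winning bids. -/
theorem ncard_rank_lt {α : Type*} [Fintype α] (r : α → α → Prop) (irrefl : ∀ a, ¬ r a a)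
    (trans : ∀ a b c, r a b → r b c → r a c) (total : ∀ a b, a ≠ b → r a b ∨ r b a)
    {k : ℕ} (hk : k ≤ Fintype.card α) :
    Set.ncard {p | Set.ncard {q | r q p} < k} = k := by
  classical
  set rank : α → ℕ := fun p => Set.ncard {q | r q p} with hrank
  have mono : ∀ a b, r a b → rank a < rank b := by
    intro a b hab
    apply Set.ncard_lt_ncard _ (Set.toFinite _)
    refine ⟨fun q hq => trans _ _ _ hq hab, fun h => irrefl a (h hab)⟩
  have inj : Function.Injective rank := by
    intro a b hab
    by_contra hne
    rcases total a b hne with h | h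
    · exact absurd hab (mono _ _ h).ne
    · exact absurd hab (mono _ _ h).ne'
  have lt : ∀ a, rank a < Fintype.card α := by
    intro a
    rw [← Nat.card_eq_fintype_card, ← Set.ncard_univ]
    apply Set.ncard_lt_ncard _ (Set.toFinite _)
    exact ⟨Set.subset_univ _, fun h => irrefl a (h (Set.mem_univ a))⟩
  have himg : Finset.univ.image rank = Finset.range (Fintype.card α) := by
    apply Finset.eq_of_subset_of_card_le
    · intro t ht
      obtain ⟨a, -, rfl⟩ := Finset.mem_image.1 ht
      exact Finset.mem_range.2 (lt a)
    · rw [Finset.card_range, Finset.card_image_of_injective _ inj, Finset.card_univ]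
  have h : rank '' {p | rank p < k} = (Finset.range k : Set ℕ) := by
    ext t
    simp only [Set.mem_image, Set.mem_ofPred_eq, Finset.coe_range, Set.mem_Iio]
    constructor
    · rintro ⟨p, hp, rfl⟩; exact hp
    · intro ht
      have : t ∈ Finset.univ.image rank := by
        rw [himg]; exact Finset.mem_range.2 (ht.trans_le hk)
      obtain ⟨a, -, rfl⟩ := Finset.mem_image.1 this
      exact ⟨a, ht, rfl⟩
  rw [← Set.ncard_image_of_injective _ inj, h, Set.ncard_coe_finset, Finset.card_range]

section Auction

variable {n m : ℕ} {prio : Fin n × Fin m → ℕ}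

theorem ncard_isWinningBid (hn : 1 ≤ n) (hprio : Function.Injective prio)
    (b : Fin n → Fin m → ℝ) : Set.ncard {p | IsWinningBid prio b p} = m := by
  apply ncard_rank_lt (RankedBefore prio b)
  · rintro a (h | h)
    · exact lt_irrefl _ h
    · exact lt_irrefl _ h.2
  · rintro a b c (h | ⟨h, h'⟩) (k | ⟨k, k'⟩)
    · exact Or.inl (k.trans h)
    · exact Or.inl (k ▸ h)
    · exact Or.inl (h ▸ k)
    · exact Or.inr ⟨h.trans k, h'.trans k'⟩
  · intro p q hpq
    rcases lt_trichotomy (b p.1 p.2) (b q.1 q.2) with h | h | h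
    · exact Or.inr (Or.inl h)
    · rcases lt_or_gt_of_ne (fun e => hpq (hprio e)) with h' | h'
      · exact Or.inl (Or.inr ⟨h, h'⟩)
      · exact Or.inr (Or.inr ⟨h.symm, h'⟩)
    · exact Or.inl (Or.inl h)
  · simpa using Nat.le_mul_of_pos_left m hn

theorem unitsWon_add_ncard (hn : 1 ≤ n) (hprio : Function.Injective prio)
    (b : Fin n → Fin m → ℝ) (i : Fin n) :
    unitsWon prio b i + Set.ncard {p | IsWinningBid prio b p ∧ p.1 ≠ i} = m := by
  have h1 : unitsWon prio b i = Set.ncard {p | IsWinningBid prio b p ∧ p.1 = i} := by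
    unfold unitsWon
    rw [← Set.ncard_image_of_injective _ (Prod.mk_right_injective i)]
    congr 1
    ext ⟨a, μ⟩
    simp only [Set.mem_image, Set.mem_ofPred_eq, Prod.mk.injEq]
    constructor
    · rintro ⟨ν, h, rfl, rfl⟩; exact ⟨h, rfl⟩
    · rintro ⟨h, rfl⟩; exact ⟨μ, h, rfl, rfl⟩
  rw [h1, ← Set.ncard_union_eq _ (Set.toFinite _) (Set.toFinite _)]
  · conv_rhs => rw [← ncard_isWinningBid hn hprio b]
    congr 1
    ext p
    simp only [Set.mem_union, Set.mem_ofPred_eq]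
    tauto
  · rw [Set.disjoint_left]
    exact fun p hp hp' => hp'.2 hp.2

theorem unitsWon_le (b : Fin n → Fin m → ℝ) (i : Fin n) : unitsWon prio b i ≤ m := by
  unfold unitsWon
  exact (Set.ncard_le_card _).trans (by simp)

theorem bidProfile_self (i : Fin n) (x : Fin m → ℝ) (y : {i' : Fin n // i' ≠ i} → Fin m → ℝ) :
    bidProfile i x y i = x := by simp [bidProfile]

theorem bidProfile_of_ne {i i' : Fin n} (h : i' ≠ i) (x : Fin m → ℝ)
    (y : {i' : Fin n // i' ≠ i} → Fin m → ℝ) : bidProfile i x y i' = y ⟨i', h⟩ := by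
  simp [bidProfile, h]

/-- The number of units won by an agent depends only on how each of her bids compares with each
of the bids of the other agents. -/
theorem unitsWon_bidProfile_congr (hn : 1 ≤ n) (hprio : Function.Injective prio) (i : Fin n)
    (x x' : Fin m → ℝ) (y : {i' : Fin n // i' ≠ i} → Fin m → ℝ)
    (h : ∀ μ i' μ', (x μ < y i' μ' ∧ x' μ < y i' μ') ∨ (y i' μ' < x μ ∧ y i' μ' < x' μ)) :
    unitsWon prio (bidProfile i x y) i = unitsWon prio (bidProfile i x' y) i := by
  -- The order among agent `i`'s own bids may change, so the others' winning bids are counted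
  -- instead: their ranks involve only comparisons that are preserved, and the two counts sum to
  -- `m`.
  have key : {p : Fin n × Fin m | IsWinningBid prio (bidProfile i x y) p ∧ p.1 ≠ i} =
      {p | IsWinningBid prio (bidProfile i x' y) p ∧ p.1 ≠ i} := by
    ext p
    simp only [Set.mem_ofPred_eq, and_congr_left_iff]
    intro hp
    unfold IsWinningBid
    suffices hs : ∀ q, RankedBefore prio (bidProfile i x y) q p ↔
        RankedBefore prio (bidProfile i x' y) q p by simp only [hs]
    rintro ⟨a, μ⟩
    unfold RankedBefore
    by_cases ha : a = i
    · subst ha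
      simp only [bidProfile_self, bidProfile_of_ne hp]
      rcases h μ ⟨p.1, hp⟩ p.2 with h | h
      · simp [h.1.ne, h.2.ne, h.1.not_gt, h.2.not_gt]
      · simp [h.1, h.2]
    · simp only [bidProfile_of_ne hp, bidProfile_of_ne ha]
  have h1 := unitsWon_add_ncard hn hprio (bidProfile i x y) i
  have h2 := unitsWon_add_ncard hn hprio (bidProfile i x' y) i
  rw [key] at h1
  omega

/-- Otherwise `p` and all bids ranked before it, at least `m + 1` in total, would win under `b'`. -/
theorem exists_losing_ge (hn : 1 ≤ n) (hprio : Function.Injective prio)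
    {b b' : Fin n → Fin m → ℝ} {d : ℝ} (hd : ∀ i μ, |b i μ - b' i μ| ≤ d)
    {p : Fin n × Fin m} (hp : ¬ IsWinningBid prio b p) :
    ∃ q, ¬ IsWinningBid prio b' q ∧ b p.1 p.2 ≤ b' q.1 q.2 + d := by
  by_contra! hcon
  have hsub : insert p {q | RankedBefore prio b q p} ⊆ {q | IsWinningBid prio b' q} := by
    intro q hq
    by_contra hq'
    have h1 := hcon q hq'
    have h2 : b p.1 p.2 ≤ b q.1 q.2 := by
      rcases hq with rfl | h | h
      · exact le_rfl
      · exact h.le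
      · exact h.1.ge
    have h3 := (abs_le.1 (hd q.1 q.2)).2
    linarith
  have h1 := Set.ncard_le_ncard hsub (Set.toFinite _)
  rw [ncard_isWinningBid hn hprio, Set.ncard_insert_of_notMem _ (Set.toFinite _)] at h1
  · unfold IsWinningBid at hp
    omega
  · rintro (h | h)
    · exact lt_irrefl _ h
    · exact lt_irrefl _ h.2

theorem bddAbove_losing (b : Fin n → Fin m → ℝ) :
    BddAbove {x | ∃ p : Fin n × Fin m, ¬ IsWinningBid prio b p ∧ x = b p.1 p.2} := by
  apply Set.Finite.bddAbove
  apply (Set.finite_range (fun p : Fin n × Fin m => b p.1 p.2)).subset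
  rintro x ⟨p, -, rfl⟩
  exact ⟨p, rfl⟩

theorem highestLosingBid_le_add (hn : 1 ≤ n) (hprio : Function.Injective prio)
    {b b' : Fin n → Fin m → ℝ} {d : ℝ} (hd0 : 0 ≤ d) (hd : ∀ i μ, |b i μ - b' i μ| ≤ d) :
    highestLosingBid prio b ≤ highestLosingBid prio b' + d := by
  have hd' : ∀ i μ, |b' i μ - b i μ| ≤ d := fun i μ => by rw [abs_sub_comm]; exact hd i μ
  by_cases hne : ∃ p, ¬ IsWinningBid prio b p
  · obtain ⟨p₀, hp₀⟩ := hne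
    unfold highestLosingBid
    refine csSup_le ⟨b p₀.1 p₀.2, p₀, hp₀, rfl⟩ ?_
    rintro x ⟨p, hp, rfl⟩
    obtain ⟨q, hq, hle⟩ := exists_losing_ge hn hprio hd hp
    have := le_csSup (bddAbove_losing (prio := prio) b') ⟨q, hq, rfl⟩
    linarith
  -- Having a losing bid is common to both profiles, so here both prices are `sSup ∅ = 0`.
  · have hne' : ¬ ∃ p, ¬ IsWinningBid prio b' p := by
      rintro ⟨p, hp⟩
      obtain ⟨q, hq, -⟩ := exists_losing_ge hn hprio hd' hp
      exact hne ⟨q, hq⟩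
    push Not at hne hne'
    simpa [highestLosingBid, hne, hne'] using hd0

theorem abs_highestLosingBid_sub_le (hn : 1 ≤ n) (hprio : Function.Injective prio)
    {b b' : Fin n → Fin m → ℝ} {d : ℝ} (hd0 : 0 ≤ d) (hd : ∀ i μ, |b i μ - b' i μ| ≤ d) :
    |highestLosingBid prio b - highestLosingBid prio b'| ≤ d := by
  have hd' : ∀ i μ, |b' i μ - b i μ| ≤ d := fun i μ => by rw [abs_sub_comm]; exact hd i μ
  have h1 := highestLosingBid_le_add hn hprio hd0 hd
  have h2 := highestLosingBid_le_add hn hprio hd0 hd'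
  rw [abs_le]
  constructor <;> linarith

theorem isWinningBid_iff_of_unitsWon_eq (hn : 1 ≤ n) (hprio : Function.Injective prio)
    {b : Fin n → Fin m → ℝ} {i : Fin n} (h : unitsWon prio b i = m) (p : Fin n × Fin m) :
    IsWinningBid prio b p ↔ p.1 = i := by
  have h0 := unitsWon_add_ncard hn hprio b i
  rw [h, Nat.add_eq_left, Set.ncard_eq_zero (Set.toFinite _)] at h0
  constructor
  · intro hp
    by_contra hpi
    exact Set.eq_empty_iff_forall_notMem.1 h0 p ⟨hp, hpi⟩
  · intro hp
    have hall : {μ : Fin m | IsWinningBid prio b (i, μ)} = Set.univ := by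
      rw [Set.eq_univ_iff_ncard, Nat.card_eq_fintype_card, Fintype.card_fin]
      exact h
    have : p.2 ∈ {μ : Fin m | IsWinningBid prio b (i, μ)} := hall ▸ Set.mem_univ _
    rw [← hp] at this
    exact this

/-- When agent `i` wins everything, the losing bids are exactly those of the others. This is what
improves the Lipschitz constant from `m` to `m - 1`. -/
theorem highestLosingBid_bidProfile_congr (hn : 1 ≤ n) (hprio : Function.Injective prio)
    {i : Fin n} {x x' : Fin m → ℝ} {y : {i' : Fin n // i' ≠ i} → Fin m → ℝ}
    (h : unitsWon prio (bidProfile i x y) i = m) (h' : unitsWon prio (bidProfile i x' y) i = m) :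
    highestLosingBid prio (bidProfile i x y) = highestLosingBid prio (bidProfile i x' y) := by
  unfold highestLosingBid
  congr 1
  ext a
  simp only [isWinningBid_iff_of_unitsWon_eq hn hprio h,
    isWinningBid_iff_of_unitsWon_eq hn hprio h', Set.mem_ofPred_eq]
  refine exists_congr fun p => and_congr_right fun hp => ?_
  rw [bidProfile_of_ne hp, bidProfile_of_ne hp]

theorem l1Dist_nonneg (x y : Fin m → ℝ) : 0 ≤ l1Dist x y :=
  Finset.sum_nonneg fun _ _ => abs_nonneg _

theorem abs_sub_le_l1Dist (x y : Fin m → ℝ) (μ : Fin m) : |x μ - y μ| ≤ l1Dist x y :=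
  Finset.single_le_sum (f := fun μ => |x μ - y μ|) (fun _ _ => abs_nonneg _) (Finset.mem_univ μ)

theorem abs_firstUnits_sub_le (x y : Fin m → ℝ) (t : ℕ) :
    |firstUnits x t - firstUnits y t| ≤ l1Dist x y := by
  unfold firstUnits l1Dist
  rw [← Finset.sum_sub_distrib]
  refine (Finset.abs_sum_le_sum_abs _ _).trans (Finset.sum_le_sum fun μ _ => ?_)
  split_ifs <;> simp

theorem abs_bidProfile_sub_le (i : Fin n) (x x' : Fin m → ℝ)
    (y : {i' : Fin n // i' ≠ i} → Fin m → ℝ) (a : Fin n) (μ : Fin m) :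
    |bidProfile i x y a μ - bidProfile i x' y a μ| ≤ l1Dist x x' := by
  by_cases ha : a = i
  · subst ha
    simpa only [bidProfile_self] using abs_sub_le_l1Dist x x' μ
  · simpa [bidProfile_of_ne ha] using l1Dist_nonneg x x'

theorem discriminatoryUtility_lipschitz (i : Fin n) (v x x' : Fin m → ℝ)
    (y : {i' : Fin n // i' ≠ i} → Fin m → ℝ)
    (h : unitsWon prio (bidProfile i x y) i = unitsWon prio (bidProfile i x' y) i) :
    |discriminatoryUtility prio i v (bidProfile i x y) -
      discriminatoryUtility prio i v (bidProfile i x' y)| ≤ 1 * l1Dist x x' := by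
  unfold discriminatoryUtility
  rw [h, bidProfile_self, bidProfile_self, sub_sub_sub_cancel_left, abs_sub_comm, one_mul]
  exact abs_firstUnits_sub_le _ _ _

theorem uniformPriceUtility_lipschitz (hn : 1 ≤ n) (hprio : Function.Injective prio)
    (hm : 1 ≤ m) (i : Fin n) (v x x' : Fin m → ℝ) (y : {i' : Fin n // i' ≠ i} → Fin m → ℝ)
    (h : unitsWon prio (bidProfile i x y) i = unitsWon prio (bidProfile i x' y) i) :
    |uniformPriceUtility prio i v (bidProfile i x y) -
      uniformPriceUtility prio i v (bidProfile i x' y)| ≤ ((m : ℝ) - 1) * l1Dist x x' := by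
  have hm' : (1 : ℝ) ≤ m := by exact_mod_cast hm
  unfold uniformPriceUtility
  rw [h, sub_sub_sub_cancel_left, ← mul_sub, abs_mul, Nat.abs_cast, abs_sub_comm]
  rcases (unitsWon_le (prio := prio) (bidProfile i x' y) i).eq_or_lt with ht | ht
  · rw [highestLosingBid_bidProfile_congr hn hprio (h.trans ht) ht, sub_self, abs_zero, mul_zero]
    exact mul_nonneg (by linarith) (l1Dist_nonneg _ _)
  · have ht' : (unitsWon prio (bidProfile i x' y) i : ℝ) + 1 ≤ m := by exact_mod_cast ht
    apply mul_le_mul (by linarith) _ (abs_nonneg _) (by linarith)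
    exact abs_highestLosingBid_sub_le hn hprio (l1Dist_nonneg _ _)
      (abs_bidProfile_sub_le i x x' y)

end Auction

/-! ### Level-set partitions and split balls -/

/-- The partition of `D` into the level sets of `t`. -/
def levelPartition {m : ℕ} (D : Set (Fin m → ℝ)) (t : (Fin m → ℝ) → ℕ) :
    Set (Set (Fin m → ℝ)) :=
  (fun s => {x ∈ D | t x = s}) '' (t '' D)

theorem isPiecewiseLipschitzOver_levelPartition {m : ℕ} {D : Set (Fin m → ℝ)} {L : ℝ}
    {u : (Fin m → ℝ) → ℝ} {t : (Fin m → ℝ) → ℕ} {M : ℕ} (ht : ∀ x, t x ≤ M)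
    (hu : ∀ x x', t x = t x' → |u x - u x'| ≤ L * l1Dist x x') :
    IsPiecewiseLipschitzOver D L u (levelPartition D t) where
  finite := by
    apply Set.Finite.image
    apply (Set.finite_Iic M).subset
    rintro _ ⟨x, -, rfl⟩
    exact ht x
  nonempty := by
    rintro _ ⟨_, ⟨x, hx, rfl⟩, rfl⟩
    exact ⟨x, hx, rfl⟩
  disjoint := by
    rintro _ ⟨s, -, rfl⟩ _ ⟨s', -, rfl⟩ hne
    rw [Function.onFun, Set.disjoint_left]
    rintro x ⟨-, h⟩ ⟨-, h'⟩
    exact hne (by simp only [← h, ← h'])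
  cover := by
    ext x
    constructor
    · rintro ⟨_, ⟨s, -, rfl⟩, hx⟩
      exact hx.1
    · intro hx
      exact ⟨_, ⟨t x, ⟨x, hx, rfl⟩, rfl⟩, hx, rfl⟩
  lipschitz := by
    rintro _ ⟨s, -, rfl⟩ x ⟨-, hx⟩ x' ⟨-, hx'⟩
    exact hu x x' (hx.trans hx'.symm)

theorem Splits.exists_ne_of_levelPartition {m : ℕ} {D A : Set (Fin m → ℝ)}
    {t : (Fin m → ℝ) → ℕ} (h : Splits (levelPartition D t) A) :
    ∃ x ∈ A, ∃ x' ∈ A, t x ≠ t x' := by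
  obtain ⟨_, ⟨s, -, rfl⟩, _, ⟨s', -, rfl⟩, hne, ⟨x, hxA, -, hx⟩, ⟨x', hxA', -, hx'⟩⟩ := h
  refine ⟨x, hxA, x', hxA', fun e => hne ?_⟩
  rw [← hx, ← hx', e]

/-- An `ℓ₁`-ball of radius `w` moves each coordinate by at most `w`, so bids farther away than that
keep their side throughout the ball. -/
theorem exists_abs_sub_le_of_splits {n m : ℕ} {prio : Fin n × Fin m → ℕ} (hn : 1 ≤ n)
    (hprio : Function.Injective prio) {i : Fin n} {y : {i' : Fin n // i' ≠ i} → Fin m → ℝ}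
    {D : Set (Fin m → ℝ)} {p : Fin m → ℝ} {w : ℝ}
    (h : Splits (levelPartition D fun x => unitsWon prio (bidProfile i x y) i)
      {x | l1Dist p x ≤ w}) :
    ∃ μ i' μ', |y i' μ' - p μ| ≤ w := by
  obtain ⟨x, hx, x', hx', hne⟩ := h.exists_ne_of_levelPartition
  by_contra! hcon
  refine hne (unitsWon_bidProfile_congr hn hprio i x x' y fun μ i' μ' => ?_)
  have h1 := abs_le.1 ((abs_sub_le_l1Dist p x μ).trans hx)
  have h2 := abs_le.1 ((abs_sub_le_l1Dist p x' μ).trans hx')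
  rcases lt_abs.1 (hcon μ i' μ') with h | h
  · left; constructor <;> linarith
  · right; constructor <;> linarith

theorem piecewiseLipschitzDispersed_auction {n m N : ℕ} {prio : Fin n × Fin m → ℕ} (hn : 1 ≤ n)
    (hm : 1 ≤ m) (hprio : Function.Injective prio) (i : Fin n) (θ : Fin m → ℝ)
    {y : Fin N → {i' : Fin n // i' ≠ i} → Fin m → ℝ} {w k : ℝ}
    (h : ∀ p : Fin m → ℝ, (Set.ncard {j | ∃ μ i' μ', |y j i' μ' - p μ| ≤ w} : ℝ) ≤ k) :
    PiecewiseLipschitzDispersed (unitCube m) 1 w k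
        (fun j x => discriminatoryUtility prio i θ (bidProfile i x (y j))) ∧
      PiecewiseLipschitzDispersed (unitCube m) ((m : ℝ) - 1) w k
        (fun j x => uniformPriceUtility prio i θ (bidProfile i x (y j))) := by
  have hsplit : ∀ p : Fin m → ℝ, (Set.ncard {j | Splits
      (levelPartition (unitCube m) fun x => unitsWon prio (bidProfile i x (y j)) i)
      {x | l1Dist p x ≤ w}} : ℝ) ≤ k := fun p =>
    le_trans (Nat.cast_le.2 (Set.ncard_le_ncard
      (fun _ hj => exists_abs_sub_le_of_splits hn hprio hj) (Set.toFinite _))) (h p)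
  exact ⟨⟨_, fun j => isPiecewiseLipschitzOver_levelPartition (fun _ => unitsWon_le _ i)
      fun x x' => discriminatoryUtility_lipschitz i θ x x' (y j), hsplit⟩,
    ⟨_, fun j => isPiecewiseLipschitzOver_levelPartition (fun _ => unitsWon_le _ i)
      fun x x' => uniformPriceUtility_lipschitz hn hprio hm i θ x x' (y j), hsplit⟩⟩

/-! ### Concentration of sample points in short intervals -/

/-- The number of sample points whose value is within `r` of the value of the sample point `j₀`. -/
noncomputable def closeCount {X : Type*} (g : X → ℝ) (r : ℝ) {N : ℕ} (j₀ : Fin N) (y : Fin N → X) : ℕ :=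
  (Finset.univ.filter fun j => |g (y j) - g (y j₀)| ≤ r).card

theorem two_pow_closeCount {X : Type*} (g : X → ℝ) (r : ℝ) {N : ℕ} (j₀ : Fin N) (y : Fin N → X) :
    (2 : ENNReal) ^ closeCount g r j₀ y = ∏ j, if |g (y j) - g (y j₀)| ≤ r then 2 else 1 := by
  rw [closeCount, Finset.prod_ite, Finset.prod_const, Finset.prod_const_one, mul_one]

/-- Recentring at a sample point in the interval doubles the radius, but replaces a continuum of
centres `a` by `N` of them. -/
theorem card_filter_abs_sub_le {X : Type*} {g : X → ℝ} {w T a : ℝ} {N : ℕ} {y : Fin N → X}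
    (hT : 0 ≤ T) (h : ∀ j₀, (closeCount g (2 * w) j₀ y : ℝ) ≤ T) :
    ((Finset.univ.filter fun j => |g (y j) - a| ≤ w).card : ℝ) ≤ T := by
  rcases (Finset.univ.filter fun j => |g (y j) - a| ≤ w).eq_empty_or_nonempty with h0 | ⟨j₀, hj₀⟩
  · simpa [h0] using hT
  · refine le_trans (Nat.cast_le.2 (Finset.card_le_card fun j hj => ?_)) (h j₀)
    simp only [Finset.mem_filter, Finset.mem_univ, true_and] at hj hj₀ ⊢
    rw [abs_le] at *
    constructor <;> linarith

section Concentration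

variable {X : Type*} [MeasurableSpace X]

theorem lintegral_pi_succAbove (ρ : Measure X) [SigmaFinite ρ] {N : ℕ} (j₀ : Fin (N + 1))
    {F : X → (Fin N → X) → ENNReal} (hF : Measurable (Function.uncurry F)) :
    ∫⁻ y, F (y j₀) (fun j => y (j₀.succAbove j)) ∂Measure.pi (fun _ : Fin (N + 1) => ρ) =
      ∫⁻ z, ∫⁻ y, F z y ∂Measure.pi (fun _ : Fin N => ρ) ∂ρ := by
  have h := measurePreserving_piFinSuccAbove (fun _ : Fin (N + 1) => ρ) j₀
  exact (h.lintegral_comp hF).trans (lintegral_prod (Function.uncurry F) hF.aemeasurable)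

theorem lintegral_pi_prod_eq_pow (ρ : Measure X) [SigmaFinite ρ] {f : X → ENNReal}
    (hf : Measurable f) (N : ℕ) :
    ∫⁻ y, ∏ j, f (y j) ∂Measure.pi (fun _ : Fin N => ρ) = (∫⁻ x, f x ∂ρ) ^ N := by
  induction N with
  | zero => simp
  | succ N ih =>
    have hg : Measurable fun y : Fin N → X => ∏ j, f (y j) := by fun_prop
    simp_rw [Fin.prod_univ_succAbove _ (0 : Fin (N + 1))]
    rw [lintegral_pi_succAbove ρ 0 (F := fun z y => f z * ∏ j, f (y j))
      (by unfold Function.uncurry; fun_prop)]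
    simp_rw [lintegral_const_mul _ hg, ih]
    rw [lintegral_mul_const _ hf, pow_succ']

theorem measurable_closeCount {g : X → ℝ} (hg : Measurable g) (r : ℝ) {N : ℕ} (j₀ : Fin N) :
    Measurable (closeCount g r j₀ : (Fin N → X) → ℕ) := by
  unfold closeCount
  simp_rw [Finset.card_filter]
  refine Finset.measurable_sum _ fun j _ => Measurable.ite ?_ measurable_const measurable_const
  exact measurableSet_le (by fun_prop) measurable_const

/-- Condition on `y j₀`: every other sample independently contributes a factor of mean at most `1 +
b`. -/
theorem lintegral_two_pow_closeCount_le (ρ : Measure X) [IsProbabilityMeasure ρ] {g : X → ℝ}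
    (hg : Measurable g) {r : ℝ} {b : ENNReal} (hb : ∀ a, ρ {x | |g x - a| ≤ r} ≤ b) {N : ℕ}
    (j₀ : Fin N) :
    ∫⁻ y, 2 ^ closeCount g r j₀ y ∂Measure.pi (fun _ : Fin N => ρ) ≤ 2 * (1 + b) ^ N := by
  obtain _ | N := N
  · exact j₀.elim0
  set f : X → X → ENNReal := fun z x => if |g x - g z| ≤ r then 2 else 1 with hf
  have hfm : Measurable (Function.uncurry f) :=
    Measurable.ite (measurableSet_le (by fun_prop) measurable_const) measurable_const
      measurable_const
  have hfm' : ∀ z, Measurable (f z) := fun z => hfm.comp measurable_prodMk_left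
  have hle : ∀ z, ∫⁻ x, f z x ∂ρ ≤ 1 + b := by
    intro z
    have hset : MeasurableSet {x | |g x - g z| ≤ r} :=
      measurableSet_le (by fun_prop) measurable_const
    have : ∀ x, f z x = 1 + Set.indicator {x | |g x - g z| ≤ r} 1 x := by
      intro x
      by_cases h : |g x - g z| ≤ r
      · simp [hf, h, one_add_one_eq_two]
      · simp [hf, h]
    simp_rw [this]
    rw [lintegral_add_left measurable_const, lintegral_indicator_one hset]
    simpa using hb (g z)
  have hprod : Measurable (Function.uncurry fun (z : X) (y : Fin N → X) => 2 * ∏ j, f z (y j)) := by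
    refine Measurable.const_mul (Finset.measurable_fun_prod _ fun j _ => ?_) _
    exact hfm.comp (measurable_fst.prodMk ((measurable_pi_apply j).comp measurable_snd))
  calc ∫⁻ y, 2 ^ closeCount g r j₀ y ∂Measure.pi (fun _ : Fin (N + 1) => ρ)
      ≤ ∫⁻ y, 2 * ∏ j, f (y j₀) (y (j₀.succAbove j)) ∂Measure.pi (fun _ : Fin (N + 1) => ρ) := by
        refine lintegral_mono fun y => ?_
        rw [two_pow_closeCount, Fin.prod_univ_succAbove _ j₀]
        -- The factor of `j₀` itself is at most `2`, whatever the sign of `r`.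
        refine mul_le_mul_left (α := ENNReal) ?_ _
        split_ifs
        · exact le_rfl
        · exact one_le_two
    _ = ∫⁻ z, ∫⁻ y, 2 * ∏ j, f z (y j) ∂Measure.pi (fun _ : Fin N => ρ) ∂ρ :=
        lintegral_pi_succAbove ρ j₀ hprod
    _ ≤ ∫⁻ _, 2 * (1 + b) ^ (N + 1) ∂ρ := by
        refine lintegral_mono fun z => ?_
        have := hfm' z
        dsimp only
        rw [lintegral_const_mul _ (by fun_prop), lintegral_pi_prod_eq_pow ρ this]
        exact mul_le_mul_right ((pow_le_pow_left₀ zero_le (hle z) N).trans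
          (pow_le_pow_right₀ le_self_add (Nat.le_succ N))) 2
    _ = 2 * (1 + b) ^ (N + 1) := by simp

theorem two_pow_mul_measure_closeCount_le (ρ : Measure X) [IsProbabilityMeasure ρ] {g : X → ℝ}
    (hg : Measurable g) {r β : ℝ} (hβ : 0 ≤ β)
    (hb : ∀ a, ρ {x | |g x - a| ≤ r} ≤ ENNReal.ofReal β) {N : ℕ} (j₀ : Fin N) (T : ℕ) :
    Measure.pi (fun _ : Fin N => ρ) {y | T ≤ closeCount g r j₀ y} ≤
      ENNReal.ofReal (2 * Real.exp (β * N) / 2 ^ T) := by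
  have h1 : (2 : ENNReal) ^ T * Measure.pi (fun _ : Fin N => ρ) {y | T ≤ closeCount g r j₀ y} ≤
      ENNReal.ofReal (2 * Real.exp (β * N)) := by
    calc _ ≤ (2 : ENNReal) ^ T * Measure.pi (fun _ : Fin N => ρ)
          {y | (2 : ENNReal) ^ T ≤ 2 ^ closeCount g r j₀ y} := by
          gcongr with y
          exact fun h => pow_le_pow_right₀ one_le_two h
      _ ≤ _ := mul_meas_ge_le_lintegral₀ (Measurable.aemeasurable
          ((measurable_of_countable (fun k : ℕ => (2 : ENNReal) ^ k)).comp
            (measurable_closeCount hg r j₀))) _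
      _ ≤ _ := lintegral_two_pow_closeCount_le ρ hg hb j₀
      _ = ENNReal.ofReal (2 * (1 + β) ^ N) := by
          rw [ENNReal.ofReal_mul zero_le_two, ENNReal.ofReal_pow (by positivity),
            ENNReal.ofReal_add zero_le_one hβ]
          simp
      _ ≤ _ := by
          apply ENNReal.ofReal_le_ofReal
          rw [mul_comm β, Real.exp_nat_mul]
          gcongr
          rw [add_comm]
          exact Real.add_one_le_exp β
  rw [ENNReal.ofReal_div_of_pos (by positivity), ENNReal.ofReal_pow zero_le_two,
    ENNReal.le_div_iff_mul_le (by simp) (by simp), mul_comm]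
  simpa using h1

end Concentration

/-! ### Bounded densities and the union bound -/

theorem HasBoundedDensity.measure_abs_sub_le {κ : ℝ} {ν : Measure ℝ} (h : HasBoundedDensity κ ν)
    (hκ : 0 ≤ κ) (a r : ℝ) : ν {x | |x - a| ≤ r} ≤ ENNReal.ofReal (κ * (2 * r)) := by
  obtain ⟨f, -, hle, rfl⟩ := h
  have hset : {x : ℝ | |x - a| ≤ r} = Metric.closedBall a r := by
    ext x; simp [Real.dist_eq]
  rw [hset, withDensity_apply _ Metric.isClosed_closedBall.measurableSet]
  calc _ ≤ ∫⁻ _ in Metric.closedBall a r, ENNReal.ofReal κ := lintegral_mono fun x => hle x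
    _ = _ := by rw [setLIntegral_const, Real.volume_closedBall, ENNReal.ofReal_mul hκ]

theorem measure_pi_abs_sub_le {ι : Type*} [Fintype ι] {m : ℕ} {κ : ℝ} (hκ : 0 ≤ κ)
    (𝒟 : ι → Measure (Fin m → ℝ)) [∀ i, IsProbabilityMeasure (𝒟 i)] (i : ι) (μ : Fin m)
    (h : HasBoundedDensity κ ((𝒟 i).map fun θ => θ μ)) (a r : ℝ) :
    Measure.pi 𝒟 {z | |z i μ - a| ≤ r} ≤ ENNReal.ofReal (κ * (2 * r)) := by
  have hset : MeasurableSet {x : ℝ | |x - a| ≤ r} :=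
    measurableSet_le (by fun_prop) measurable_const
  have h1 := h.measure_abs_sub_le hκ a r
  rw [Measure.map_apply (measurable_pi_apply μ) hset, ← (measurePreserving_eval 𝒟 i).map_eq,
    Measure.map_apply (measurable_pi_apply i) (measurable_pi_apply μ hset)] at h1
  exact h1

/-- The factor `m ^ 2` counts pairs of a coordinate of the centre and a unit of the other agent. -/
theorem ncard_exists_abs_sub_le {ι : Type*} [Fintype ι] {m N : ℕ} {w T : ℝ} (hT : 0 ≤ T)
    {y : Fin N → ι → Fin m → ℝ}
    (h : ∀ i μ j₀, (closeCount (fun z : ι → Fin m → ℝ => z i μ) (2 * w) j₀ y : ℝ) ≤ T)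
    (p : Fin m → ℝ) :
    (Set.ncard {j | ∃ μ i μ', |y j i μ' - p μ| ≤ w} : ℝ) ≤ Fintype.card ι * m ^ 2 * T := by
  classical
  have hsub : {j | ∃ μ i μ', |y j i μ' - p μ| ≤ w} ⊆
      ((Finset.univ : Finset (Fin m × ι × Fin m)).biUnion fun q =>
        Finset.univ.filter fun j => |y j q.2.1 q.2.2 - p q.1| ≤ w : Finset (Fin N)) := by
    rintro j ⟨μ, i, μ', hj⟩
    simp only [Finset.coe_biUnion, Set.mem_iUnion]
    exact ⟨(μ, i, μ'), by simp, by simpa using hj⟩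
  have h1 := Set.ncard_le_ncard hsub (Set.toFinite _)
  rw [Set.ncard_coe_finset] at h1
  have h2 : ∀ q : Fin m × ι × Fin m,
      ((Finset.univ.filter fun j => |y j q.2.1 q.2.2 - p q.1| ≤ w).card : ℝ) ≤ T := fun q =>
    card_filter_abs_sub_le (g := fun z : ι → Fin m → ℝ => z q.2.1 q.2.2) hT (h q.2.1 q.2.2)
  calc (Set.ncard {j | ∃ μ i μ', |y j i μ' - p μ| ≤ w} : ℝ)
      ≤ ∑ q : Fin m × ι × Fin m,
        ((Finset.univ.filter fun j => |y j q.2.1 q.2.2 - p q.1| ≤ w).card : ℝ) := by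
        exact_mod_cast h1.trans Finset.card_biUnion_le
    _ ≤ ∑ _ : Fin m × ι × Fin m, T := Finset.sum_le_sum fun q _ => h2 q
    _ = Fintype.card ι * m ^ 2 * T := by
        rw [Finset.sum_const, Finset.card_univ, Fintype.card_prod, Fintype.card_prod,
          Fintype.card_fin, nsmul_eq_mul]
        push_cast
        ring

theorem ncard_le_of_forall_closeCount_lt {n m N : ℕ} {w : ℝ} {T : ℕ} {i : Fin n}
    {y : Fin N → {i' : Fin n // i' ≠ i} → Fin m → ℝ}
    (h : ∀ i' μ j₀, closeCount (fun z : {i' : Fin n // i' ≠ i} → Fin m → ℝ => z i' μ)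
      (2 * w) j₀ y < T)
    (p : Fin m → ℝ) :
    (Set.ncard {j | ∃ μ i' μ', |y j i' μ' - p μ| ≤ w} : ℝ) ≤ n * m ^ 2 * T := by
  refine (ncard_exists_abs_sub_le (Nat.cast_nonneg T)
    (fun i' μ j₀ => Nat.cast_le.2 (h i' μ j₀).le) p).trans ?_
  gcongr
  simp

/-- With high probability, in every coordinate of the sampled types, every sample point has few
other sample points nearby. -/
theorem measure_exists_closeCount_ge_le {n m N : ℕ} {κ r : ℝ} (hκ : 0 ≤ κ) (hr : 0 ≤ r)
    (𝒟 : Fin n → Measure (Fin m → ℝ)) [∀ i, IsProbabilityMeasure (𝒟 i)]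
    (hd : ∀ i μ, HasBoundedDensity κ ((𝒟 i).map (fun θ => θ μ)))
    {Ω : Type*} [MeasurableSpace Ω] (P : Measure Ω)
    (S : (i : Fin n) → Ω → Fin N → {i' : Fin n // i' ≠ i} → Fin m → ℝ)
    (hS : ∀ i, Measurable (S i))
    (hlaw : ∀ i, P.map (S i) = Measure.pi (fun _ : Fin N =>
      Measure.pi (fun i' : {i' : Fin n // i' ≠ i} => 𝒟 i'.1))) (T : ℕ) :
    P (⋃ (i : Fin n) (i' : {i' : Fin n // i' ≠ i}) (μ : Fin m) (j₀ : Fin N),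
      {ω | T ≤ closeCount (fun z : {i' : Fin n // i' ≠ i} → Fin m → ℝ => z i' μ) r j₀ (S i ω)}) ≤
      ENNReal.ofReal (n ^ 2 * m * N * (2 * Real.exp (κ * (2 * r) * N) / 2 ^ T)) := by
  set ε := ENNReal.ofReal (2 * Real.exp (κ * (2 * r) * N) / 2 ^ T) with hε
  have hone : ∀ (i : Fin n) (i' : {i' : Fin n // i' ≠ i}) (μ : Fin m) (j₀ : Fin N),
      P {ω | T ≤ closeCount (fun z : {i' : Fin n // i' ≠ i} → Fin m → ℝ => z i' μ) r j₀
        (S i ω)} ≤ ε := by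
    intro i i' μ j₀
    have hg : Measurable fun z : {i' : Fin n // i' ≠ i} → Fin m → ℝ => z i' μ := by fun_prop
    have h1 := two_pow_mul_measure_closeCount_le
      (Measure.pi fun i' : {i' : Fin n // i' ≠ i} => 𝒟 i'.1) hg (by positivity)
      (fun a => measure_pi_abs_sub_le hκ (fun i' : {i' : Fin n // i' ≠ i} => 𝒟 i'.1) i' μ
        (hd i'.1 μ) a r) j₀ T
    rwa [← hlaw i, Measure.map_apply (hS i)
      (measurableSet_le measurable_const (measurable_closeCount hg r j₀))] at h1
  calc _ ≤ ∑ i : Fin n, ∑ i' : {i' : Fin n // i' ≠ i}, ∑ μ : Fin m, ∑ j₀ : Fin N, ε := by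
        refine (measure_iUnion_fintype_le _ _).trans (Finset.sum_le_sum fun i _ => ?_)
        refine (measure_iUnion_fintype_le _ _).trans (Finset.sum_le_sum fun i' _ => ?_)
        refine (measure_iUnion_fintype_le _ _).trans (Finset.sum_le_sum fun μ _ => ?_)
        exact (measure_iUnion_fintype_le _ _).trans (Finset.sum_le_sum fun j₀ _ => hone i i' μ j₀)
    _ ≤ ∑ i : Fin n, n * (m * (N * ε)) := by
        refine Finset.sum_le_sum fun i _ => ?_
        simp only [Finset.sum_const, Finset.card_univ, nsmul_eq_mul, Fintype.card_fin]
        gcongr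
        simp
    _ = _ := by
        rw [ENNReal.ofReal_mul (by positivity), ← hε, ENNReal.ofReal_mul (by positivity),
          ENNReal.ofReal_mul (by positivity), ENNReal.ofReal_pow (by positivity)]
        simp only [Finset.sum_const, Finset.card_univ, nsmul_eq_mul, Fintype.card_fin,
          ENNReal.ofReal_natCast]
        ring

/-- With `s = √N`, each of `m`, `s` and `2` is at most `exp s`, so `2 * m * N ≤ exp (4 * s)`. Since
`log 2 > 1/2`, `2 ^ T` absorbs this together with `(n / δ) ^ 2` and `exp (4 * c * s)`. -/
theorem union_bound_le {n m N T : ℕ} {c δ : ℝ} (hδ : 0 < δ) (hδ1 : δ < 1) (hn : 1 ≤ n)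
    (hN : 1 ≤ N) (hmN : (m : ℝ) ≤ √N)
    (hT : 4 * Real.log (n / δ) + (8 + 8 * c) * √N ≤ T) :
    n ^ 2 * m * N * (2 * Real.exp (4 * c * √N) / 2 ^ T) ≤ δ := by
  have hn' : (0 : ℝ) < n := by exact_mod_cast hn
  have hs1 : 1 ≤ √(N : ℝ) := Real.one_le_sqrt.2 (by exact_mod_cast hN)
  have hsN : √(N : ℝ) * √(N : ℝ) = N := Real.mul_self_sqrt (Nat.cast_nonneg N)
  set s := √(N : ℝ)
  have he : s ≤ Real.exp s := by linarith [Real.add_one_le_exp s]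
  have he2 : 2 ≤ Real.exp s := by linarith [Real.add_one_le_exp s]
  have hTexp : Real.exp (T / 2) ≤ 2 ^ T := by
    rw [← Real.exp_log (show (0 : ℝ) < 2 ^ T by positivity), Real.log_pow]
    apply Real.exp_le_exp.2
    have := Real.log_two_gt_d9
    nlinarith [Nat.cast_nonneg (α := ℝ) T]
  have hexp : (n / δ) ^ 2 * (Real.exp s) ^ 4 * Real.exp (4 * c * s) ≤ 2 ^ T := by
    refine le_trans (le_of_eq ?_) ((Real.exp_le_exp.2
      (show 2 * Real.log (n / δ) + 4 * s + 4 * c * s ≤ T / 2 by linarith)).trans hTexp)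
    rw [Real.exp_add, Real.exp_add, ← Real.exp_nat_mul s 4]
    congr 2
    · rw [← Real.exp_log (show 0 < (n / δ : ℝ) by positivity), ← Real.exp_nat_mul, Real.log_exp]
      norm_num
  have hprod : (m : ℝ) * N * 2 ≤ (Real.exp s) ^ 4 := by
    calc (m : ℝ) * N * 2 ≤ Real.exp s * (Real.exp s * Real.exp s) * Real.exp s := by
          rw [← hsN]
          gcongr
          exact hmN.trans he
      _ = _ := by ring
  rw [← mul_div_assoc, div_le_iff₀ (by positivity)]
  calc (n : ℝ) ^ 2 * m * N * (2 * Real.exp (4 * c * s))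
      = n ^ 2 * (m * N * 2) * Real.exp (4 * c * s) := by ring
    _ ≤ (n ^ 2 / δ) * (Real.exp s) ^ 4 * Real.exp (4 * c * s) := by
        gcongr
        rw [le_div_iff₀ hδ]
        nlinarith [sq_nonneg (n : ℝ)]
    _ = δ * ((n / δ) ^ 2 * (Real.exp s) ^ 4 * Real.exp (4 * c * s)) := by
        field_simp
    _ ≤ δ * 2 ^ T := by gcongr

/-! ### Choice of constants and degenerate parameters -/

theorem mainTheorem9 (c : ℝ) (hc : 0 < c) :
    ∃ C : ℝ, 0 < C ∧
      ∀ (n m N : ℕ), 1 ≤ m → 1 ≤ N →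
      ∀ (κ δ : ℝ), 0 < κ → 0 < δ → δ < 1 →
      ∀ (prio : Fin n × Fin m → ℕ), Function.Injective prio →
      -- the independent type distributions of the agents
      ∀ (𝒟 : Fin n → Measure (Fin m → ℝ)), (∀ i, IsProbabilityMeasure (𝒟 i)) →
        (∀ i, ∀ᵐ θ ∂(𝒟 i), θ ∈ unitCube m) →
        (∀ i μ, HasBoundedDensity κ ((𝒟 i).map (fun θ => θ μ))) →
      -- the sample sets: the set of agent `i` consists of `N` independent draws of the types
      -- of the other agents; the sets of different agents may depend on each other
      ∀ {Ω : Type*} [MeasurableSpace Ω] (P : Measure Ω) [IsProbabilityMeasure P]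
        (S : (i : Fin n) → Ω → Fin N → {i' : Fin n // i' ≠ i} → Fin m → ℝ),
        (∀ i, Measurable (S i)) →
        (∀ i, P.map (S i) = Measure.pi (fun _ : Fin N =>
          Measure.pi (fun i' : {i' : Fin n // i' ≠ i} => 𝒟 i'.1))) →
      ∃ E : Set Ω, MeasurableSet E ∧ ENNReal.ofReal (1 - δ) ≤ P E ∧
        ∀ ω ∈ E, ∀ i : Fin n, ∀ θ ∈ unitCube m,
          PiecewiseLipschitzDispersed (unitCube m) 1
            (c / (κ * √(N : ℝ)))
            (C * (n * m ^ 2 * √(N * Real.log (n / δ))))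
            (fun j x => discriminatoryUtility prio i θ (bidProfile i x (S i ω j))) ∧
          PiecewiseLipschitzDispersed (unitCube m) ((m : ℝ) - 1)
            (c / (κ * √(N : ℝ)))
            (C * (n * m ^ 2 * √(N * Real.log (n / δ))))
            (fun j x => uniformPriceUtility prio i θ (bidProfile i x (S i ω j))) := by
  refine ⟨22 + 16 * c, by positivity, ?_⟩
  intro n m N hm hN κ δ hκ hδ hδ1 prio hprio 𝒟 hprob _ hd Ω _ P _ S hS hlaw
  set k : ℝ := (22 + 16 * c) * (n * m ^ 2 * √(N * Real.log (n / δ))) with hk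
  have hN' : (1 : ℝ) ≤ N := by exact_mod_cast hN
  have hm' : (1 : ℝ) ≤ m := by exact_mod_cast hm
  have hs1 : 1 ≤ √(N : ℝ) := Real.one_le_sqrt.2 hN'
  have hsN : √(N : ℝ) * √(N : ℝ) = N := Real.mul_self_sqrt (Nat.cast_nonneg N)
  have hk0 : 0 ≤ k := by positivity
  have htriv : (∀ (i : Fin n) (y : Fin N → {i' : Fin n // i' ≠ i} → Fin m → ℝ) (p : Fin m → ℝ),
      (Set.ncard {j | ∃ μ i' μ', |y j i' μ' - p μ| ≤ c / (κ * √(N : ℝ))} : ℝ) ≤ k) →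
      ∃ E : Set Ω, MeasurableSet E ∧ ENNReal.ofReal (1 - δ) ≤ P E ∧
        ∀ ω ∈ E, ∀ i : Fin n, ∀ p : Fin m → ℝ,
          (Set.ncard {j | ∃ μ i' μ', |S i ω j i' μ' - p μ| ≤ c / (κ * √(N : ℝ))} : ℝ) ≤ k := by
    refine fun h => ⟨Set.univ, MeasurableSet.univ, ?_, fun ω _ i p => h i (S i ω) p⟩
    rw [measure_univ]
    exact ENNReal.ofReal_le_one.2 (by linarith)
  suffices hmain : ∃ E : Set Ω, MeasurableSet E ∧ ENNReal.ofReal (1 - δ) ≤ P E ∧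
      ∀ ω ∈ E, ∀ i : Fin n, ∀ p : Fin m → ℝ,
        (Set.ncard {j | ∃ μ i' μ', |S i ω j i' μ' - p μ| ≤ c / (κ * √(N : ℝ))} : ℝ) ≤ k by
    obtain ⟨E, hE, hPE, h⟩ := hmain
    exact ⟨E, hE, hPE, fun ω hω i θ _ => piecewiseLipschitzDispersed_auction
      (Nat.one_le_of_lt i.isLt) hm hprio i θ (h ω hω i)⟩
  -- Without other agents no ball is split. For `n ≥ 2` the logarithm is bounded below by `log 2`.
  rcases Nat.lt_or_ge n 2 with hn2 | hn2
  · refine htriv fun i y p => ?_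
    have : IsEmpty {i' : Fin n // i' ≠ i} := ⟨fun i' => i'.2 (Fin.ext (by omega))⟩
    simpa using hk0
  have hn' : (2 : ℝ) ≤ n := by exact_mod_cast hn2
  set ℓ := Real.log (n / δ) with hℓ
  have hℓ2 : 1 / 2 ≤ ℓ := by
    have h1 : Real.log 2 ≤ ℓ := by
      apply Real.log_le_log two_pos
      rw [le_div_iff₀ hδ]
      nlinarith
    linarith [Real.log_two_gt_d9]
  have hsq : √(N * ℓ) = √(N : ℝ) * √ℓ := Real.sqrt_mul (by positivity) _
  have hsℓ : 1 / 2 ≤ √ℓ := Real.le_sqrt_of_sq_le (by linarith)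
  have hsR : √(N : ℝ) ≤ 2 * √(N * ℓ) := by rw [hsq]; nlinarith
  have hcard : ∀ s : Set (Fin N), (s.ncard : ℝ) ≤ N := fun s => by
    exact_mod_cast (Set.ncard_le_card s).trans (by simp)
  have hkT : ∀ t : ℝ, t ≤ (22 + 16 * c) * √(N * ℓ) → n * m ^ 2 * t ≤ k := fun t ht => by
    rw [hk, mul_left_comm]
    gcongr
  have htriv' : (N : ℝ) ≤ k → _ := fun h => htriv fun i y p => (hcard _).trans h
  by_cases hℓN : (N : ℝ) < ℓ
  · apply htriv'
    have h1 : (N : ℝ) ≤ √(N * ℓ) := Real.le_sqrt_of_sq_le (by nlinarith)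
    refine le_trans ?_ (hkT N (by nlinarith [Real.sqrt_nonneg (N * ℓ)]))
    have : (1 : ℝ) ≤ n * m ^ 2 := by nlinarith
    nlinarith
  by_cases hmN : √(N : ℝ) < m
  · apply htriv'
    refine le_trans ?_ (hkT √N (by nlinarith [Real.sqrt_nonneg (N * ℓ)]))
    calc (N : ℝ) = √(N : ℝ) * √(N : ℝ) := hsN.symm
      _ ≤ n * m ^ 2 * √(N : ℝ) := by
          gcongr
          nlinarith
  push Not at hℓN hmN
  set T : ℕ := ⌈4 * ℓ + (8 + 8 * c) * √(N : ℝ)⌉₊ with hT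
  -- From `ℓ ≤ √(N * ℓ)` and `1 ≤ √N ≤ 2 * √(N * ℓ)`: `4` from `ℓ`, `16 + 16 * c` from `√N`, and `2`
  -- from rounding up.
  have hTle : (T : ℝ) ≤ (22 + 16 * c) * √(N * ℓ) := by
    have h1 : (T : ℝ) < 4 * ℓ + (8 + 8 * c) * √(N : ℝ) + 1 :=
      Nat.ceil_lt_add_one (by positivity)
    have h2 : ℓ ≤ √(N * ℓ) := Real.le_sqrt_of_sq_le (by nlinarith)
    nlinarith
  set r : ℝ := 2 * (c / (κ * √(N : ℝ))) with hr
  have hbad := measure_exists_closeCount_ge_le hκ.le (r := r) (by positivity) 𝒟 hd P S hS hlaw T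
  -- One `2` is the recentring, the other the length of an interval of radius `r`.
  have hexp : κ * (2 * r) * N = 4 * c * √(N : ℝ) := by
    rw [hr]
    nth_rewrite 2 [← hsN]
    field_simp
    ring
  rw [hexp] at hbad
  replace hbad := hbad.trans (ENNReal.ofReal_le_ofReal
    (union_bound_le hδ hδ1 (by omega) hN hmN (Nat.le_ceil _)))
  set B : Set Ω := ⋃ (i : Fin n) (i' : {i' : Fin n // i' ≠ i}) (μ : Fin m) (j₀ : Fin N),
    {ω | T ≤ closeCount (fun z : {i' : Fin n // i' ≠ i} → Fin m → ℝ => z i' μ) r j₀ (S i ω)}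
    with hB
  have hBm : MeasurableSet B := by
    refine MeasurableSet.iUnion fun i => MeasurableSet.iUnion fun i' =>
      MeasurableSet.iUnion fun μ => MeasurableSet.iUnion fun j₀ => ?_
    exact measurableSet_le measurable_const
      ((measurable_closeCount (by fun_prop) r j₀).comp (hS i))
  refine ⟨Bᶜ, hBm.compl, ?_, fun ω hω i p => ?_⟩
  · rw [prob_compl_eq_one_sub hBm, ENNReal.ofReal_sub _ hδ.le, ENNReal.ofReal_one]
    exact tsub_le_tsub_left hbad _
  · refine (ncard_le_of_forall_closeCount_lt (T := T) (fun i' μ j₀ => ?_) p).trans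
      (hkT T hTle)
    by_contra hcon
    refine hω ?_
    simp only [hB, Set.mem_iUnion]
    exact ⟨i, i', μ, j₀, not_lt.1 hcon⟩
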